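/- Let $R$ be a commutative ring with $2\in R^\times$ and let $n\ge 3$. Let $Um_n(R)$ be the set of unimodular vectors, i.e. of $v=(v_1,\dots,v_n)^t\in R^n$ with $\langle v_1,\dots,v_n\rangle=R$, on which $SL_n(R)$ acts by matrix multiplication. Let $q(a,b)=\sum_{i=1}^n a_ib_i$ on $R^n\oplus R^n$, let $U_{2n-1}(R)=\{(a,b)\in R^n\oplus R^n : q(a,b)=1\}$, and let $SO_{2n}(R)$ be the group of invertible $2n\times 2n$ matrices of determinant $1$ that preserve $q$; it acts on $U_{2n-1}(R)$ by matrix multiplication, and $St(x,y)\subseteq SO_{2n}(R)$ denotes the stabilizer of $(x,y)\in U_{2n-1}(R)$. Let $H:SL_n(R)\to SO_{2n}(R)$ be the homomorphism $H(\sigma)=\begin{pmatrix}\sigma&0\\0&(\sigma^t)^{-1}\end{pmatrix}$, and let $EO_{2n}(R)\subseteq SO_{2n}(R)$ be the subgroup generated by the elementary orthogonal matrices $I+zE_{ij}-zE_{\partial(j)\partial(i)}$ with $z\in R$, $1\le i,j\le 2n$, $i\ne j$, $i\neq\partial(j)$, where $\partial$ is the permutation of $\{1,\dots,2n\}$ that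 exchanges $k$ and $n+k$ for $1\le k\le n$. Sending $v\in Um_n(R)$ to the orbit of $(v,w)$, where $w\in R^n$ is any vector with $q(v,w)=1$, induces a well-defined map $$Um_n(R)/SL_n(R)\longrightarrow U_{2n-1}(R)/SO_{2n}(R).$$ (1) This map is surjective, and it is injective (and hence bijective) if and only if, for every $(x,y)\in U_{2n-1}(R)$, $$SO_{2n}(R)=H(SL_n(R))\,EO_{2n}(R)\,St(x,y).$$ (2) The orbit space $Um_n(R)/SL_n(R)$ is trivial (has exactly one element) if and only if the orbit space $U_{2n-1}(R)/SO_{2n}(R)$ is trivial and $$SO_{2n}(R)=H(SL_n(R))\,EO_{2n}(R)\,St(u_n),$$ where $u_n=(e_n,e_n)$ and $e_n=(1,0,\dots,0)^t\in R^n$. -/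

import Mathlib

open scoped Pointwise

namespace UnitVec

open Matrix

variable (R : Type*) [CommRing R] (n : ℕ)

/-- `Um_n(R)`: vectors in `R^n` whose entries generate the unit ideal. -/
def Um : Type _ := {v : Fin n → R // Ideal.span (Set.range v) = ⊤}

variable {R n}

theorem span_range_eq_top_iff (v : Fin n → R) :
    Ideal.span (Set.range v) = ⊤ ↔ ∃ w : Fin n → R, v ⬝ᵥ w = 1 := by
  rw [Ideal.eq_top_iff_one, Ideal.mem_span_range_iff_exists_fun]
  simp only [dotProduct, mul_comm]

/-- A unimodular vector has a section. -/
theorem Um.exists_section (v : Um R n) : ∃ w : Fin n → R, v.1 ⬝ᵥ w = 1 :=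
  (span_range_eq_top_iff v.1).1 v.2

theorem inv_mul_coe (g : SpecialLinearGroup (Fin n) R) :
    ((g⁻¹ : SpecialLinearGroup (Fin n) R) : Matrix (Fin n) (Fin n) R) *
      (g : Matrix (Fin n) (Fin n) R) = 1 :=
  congrArg Subtype.val (inv_mul_cancel g)

theorem Um.mulVec_mem (g : SpecialLinearGroup (Fin n) R) (v : Um R n) :
    Ideal.span (Set.range ((g : Matrix (Fin n) (Fin n) R) *ᵥ v.1)) = ⊤ := by
  obtain ⟨w, hw⟩ := v.exists_section
  refine (span_range_eq_top_iff _).2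
    ⟨((g⁻¹ : SpecialLinearGroup (Fin n) R) : Matrix (Fin n) (Fin n) R)ᵀ *ᵥ w, ?_⟩
  rw [mulVec_transpose, dotProduct_comm, ← dotProduct_mulVec, mulVec_mulVec,
    inv_mul_coe, one_mulVec,
    dotProduct_comm, hw]

/-- `SL_n(R)` acts on `Um_n(R)` by matrix multiplication on column vectors. -/
instance : MulAction (SpecialLinearGroup (Fin n) R) (Um R n) where
  smul g v := ⟨(g : Matrix (Fin n) (Fin n) R) *ᵥ v.1, Um.mulVec_mem g v⟩
  one_smul v := Subtype.ext (by
    change ((1 : SpecialLinearGroup (Fin n) R) : Matrix (Fin n) (Fin n) R) *ᵥ v.1 = v.1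
    simp)
  mul_smul g h v := Subtype.ext (by
    change ((g * h : SpecialLinearGroup (Fin n) R) : Matrix (Fin n) (Fin n) R) *ᵥ v.1 =
      (g : Matrix (Fin n) (Fin n) R) *ᵥ ((h : Matrix (Fin n) (Fin n) R) *ᵥ v.1)
    simp)

/-- The hyperbolic quadratic form `q(a, b) = ∑ i, a i * b i` on `R^n ⊕ R^n`; the vector `(a, b)`
is `Sum.elim a b`. -/
def hypForm (x : Fin n ⊕ Fin n → R) : R := ∑ i, x (Sum.inl i) * x (Sum.inr i)

theorem hypForm_elim (a b : Fin n → R) : hypForm (Sum.elim a b) = a ⬝ᵥ b := rfl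

variable (R n)

/-- `U_{2n-1}(R)`: the vectors `(a, b)` in `R^n ⊕ R^n` with `q(a, b) = 1`. -/
def UnitVectors : Type _ := {x : Fin n ⊕ Fin n → R // hypForm x = 1}

/-- `O_{2n}(R)`: invertible `2n × 2n`-matrices preserving `q`. -/
def O : Subgroup (GL (Fin n ⊕ Fin n) R) where
  carrier := {g | ∀ x, hypForm ((g : Matrix (Fin n ⊕ Fin n) (Fin n ⊕ Fin n) R) *ᵥ x) = hypForm x}
  one_mem' := by intro x; simp
  mul_mem' := by
    intro g h hg hh x
    rw [Units.val_mul, ← mulVec_mulVec, hg, hh]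
  inv_mem' := by
    intro g hg x
    rw [← hg, mulVec_mulVec, ← Units.val_mul, mul_inv_cancel, Units.val_one, one_mulVec]

/-- `SO_{2n}(R)`: the matrices of determinant `1` in `O_{2n}(R)`. -/
def SO : Subgroup (GL (Fin n ⊕ Fin n) R) := O R n ⊓ (GeneralLinearGroup.det).ker

variable {R n}

/-- Build an element of `SO_{2n}(R)` from a matrix of determinant `1` that preserves `q`. -/
def SO.mk (M : Matrix (Fin n ⊕ Fin n) (Fin n ⊕ Fin n) R) (hdet : M.det = 1)
    (hq : ∀ x, hypForm (M *ᵥ x) = hypForm x) : SO R n :=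
  ⟨SpecialLinearGroup.toGL ⟨M, hdet⟩,
    hq, Units.ext hdet⟩

/-- The underlying `2n × 2n`-matrix. -/
def SO.toMatrix (g : SO R n) : Matrix (Fin n ⊕ Fin n) (Fin n ⊕ Fin n) R :=
  (g : GL (Fin n ⊕ Fin n) R)

theorem SO.toMatrix_mk (M : Matrix (Fin n ⊕ Fin n) (Fin n ⊕ Fin n) R) (hdet : M.det = 1)
    (hq : ∀ x, hypForm (M *ᵥ x) = hypForm x) : SO.toMatrix (SO.mk M hdet hq) = M := rfl

theorem SO.toMatrix_one : SO.toMatrix (1 : SO R n) = 1 := rfl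

theorem SO.toMatrix_mul (g h : SO R n) : SO.toMatrix (g * h) = SO.toMatrix g * SO.toMatrix h := rfl

theorem SO.toMatrix_injective : Function.Injective (SO.toMatrix (R := R) (n := n)) :=
  fun _ _ h => Subtype.ext (Units.ext h)

theorem SO.hypForm_mulVec (g : SO R n) (x : Fin n ⊕ Fin n → R) :
    hypForm (SO.toMatrix g *ᵥ x) = hypForm x := g.2.1 x

/-- `SO_{2n}(R)` acts on `U_{2n-1}(R)` by matrix multiplication on column vectors. -/
instance : MulAction (SO R n) (UnitVectors R n) where
  smul g x := ⟨SO.toMatrix g *ᵥ x.1, (SO.hypForm_mulVec g x.1).trans x.2⟩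
  one_smul x := Subtype.ext (one_mulVec x.1)
  mul_smul g h x := Subtype.ext (mulVec_mulVec x.1 (SO.toMatrix g) (SO.toMatrix h)).symm

/-- The matrix `H(σ)`, block diagonal with blocks `σ` and `(σᵗ)⁻¹`. -/
def hypMatrix (σ : SpecialLinearGroup (Fin n) R) :
    Matrix (Fin n ⊕ Fin n) (Fin n ⊕ Fin n) R :=
  fromBlocks (σ : Matrix (Fin n) (Fin n) R) 0 0
    ((σ⁻¹ : SpecialLinearGroup (Fin n) R) : Matrix (Fin n) (Fin n) R)ᵀ

theorem hypMatrix_det (σ : SpecialLinearGroup (Fin n) R) : (hypMatrix σ).det = 1 := by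
  rw [hypMatrix, det_fromBlocks_zero₂₁, det_transpose, σ.2, (σ⁻¹).2, one_mul]

theorem hypForm_hypMatrix (σ : SpecialLinearGroup (Fin n) R) (x : Fin n ⊕ Fin n → R) :
    hypForm (hypMatrix σ *ᵥ x) = hypForm x := by
  obtain ⟨a, b, rfl⟩ : ∃ a b, x = Sum.elim a b :=
    ⟨x ∘ Sum.inl, x ∘ Sum.inr, (Sum.elim_comp_inl_inr x).symm⟩
  rw [hypMatrix, fromBlocks_mulVec, Sum.elim_comp_inl, Sum.elim_comp_inr, hypForm_elim,
    hypForm_elim, zero_mulVec, zero_mulVec, add_zero, zero_add, mulVec_transpose,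
    dotProduct_comm, ← dotProduct_mulVec, mulVec_mulVec, inv_mul_coe, one_mulVec, dotProduct_comm]

/-- The hyperbolic homomorphism `H : SL_n(R) → SO_{2n}(R)`. -/
def hyp : SpecialLinearGroup (Fin n) R →* SO R n where
  toFun σ := SO.mk (hypMatrix σ) (hypMatrix_det σ) (hypForm_hypMatrix σ)
  map_one' := SO.toMatrix_injective (by
    rw [SO.toMatrix_mk, SO.toMatrix_one]
    simp [hypMatrix])
  map_mul' σ τ := SO.toMatrix_injective (by
    rw [SO.toMatrix_mul, SO.toMatrix_mk, SO.toMatrix_mk, SO.toMatrix_mk]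
    simp [hypMatrix, fromBlocks_multiply])

/-- The matrix `1 + z E_{ij} - z E_{∂(j)∂(i)}`, where `∂` is the involution of the index set that
exchanges the two copies of `{1, …, n}`. -/
def elemMatrix (i j : Fin n ⊕ Fin n) (z : R) : Matrix (Fin n ⊕ Fin n) (Fin n ⊕ Fin n) R :=
  1 + single i j z - single j.swap i.swap z

theorem elemMatrix_det {i j : Fin n ⊕ Fin n} (hij : i ≠ j) (z : R) :
    (elemMatrix i j z).det = 1 := by
  have h : elemMatrix i j z = transvection i j z * transvection j.swap i.swap (-z) := by
    have hj : j ≠ j.swap := by cases j <;> simp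
    simp only [elemMatrix, transvection, mul_add, add_mul, mul_one, one_mul,
      single_mul_single_of_ne _ _ _ _ hj, add_zero, sub_eq_add_neg, single_neg]
  have hs : j.swap ≠ i.swap := fun h => hij (Sum.swap_leftInverse.injective h.symm)
  rw [h, det_mul, det_transvection_of_ne _ _ hij, det_transvection_of_ne _ _ hs, one_mul]

theorem hypForm_add_single (x : Fin n ⊕ Fin n → R) (k : Fin n ⊕ Fin n) (c : R) :
    hypForm (x + Pi.single k c) = hypForm x + c * x k.swap := by
  rcases k with k | k <;>
  simp [hypForm, add_mul, mul_add, Finset.sum_add_distrib, Pi.single_apply, mul_comm]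

theorem hypForm_elemMatrix {i j : Fin n ⊕ Fin n} (hij : i ≠ j) (z : R)
    (x : Fin n ⊕ Fin n → R) : hypForm (elemMatrix i j z *ᵥ x) = hypForm x := by
  have h : elemMatrix i j z *ᵥ x =
      x + Pi.single i (z * x j) + Pi.single j.swap (-(z * x i.swap)) := by
    rw [elemMatrix, sub_mulVec, add_mulVec, one_mulVec, sub_eq_add_neg, Pi.single_neg]
    simp only [single_mulVec]
    rfl
  rw [h, hypForm_add_single, hypForm_add_single, Sum.swap_swap]
  simp [hij.symm]
  ring

/-- The elementary orthogonal matrix with parameters `i ≠ j` and `z`. -/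
def elem {i j : Fin n ⊕ Fin n} (hij : i ≠ j) (z : R) : SO R n :=
  SO.mk (elemMatrix i j z) (elemMatrix_det hij z) (hypForm_elemMatrix hij z)

variable (R n)

/-- `EO_{2n}(R)`: the subgroup of `SO_{2n}(R)` generated by the elementary orthogonal matrices
`1 + z E_{ij} - z E_{∂(j)∂(i)}` with `i ≠ j` and `i ≠ ∂(j)`. -/
def EO : Subgroup (SO R n) :=
  Subgroup.closure {g | ∃ (i j : Fin n ⊕ Fin n) (hij : i ≠ j) (z : R), i ≠ j.swap ∧ g = elem hij z}

/-- The orbit space `Um_n(R)/SL_n(R)`. -/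
abbrev UmModSL : Type _ := MulAction.orbitRel.Quotient (SpecialLinearGroup (Fin n) R) (Um R n)

/-- The orbit space `U_{2n-1}(R)/SO_{2n}(R)`. -/
abbrev UModSO : Type _ := MulAction.orbitRel.Quotient (SO R n) (UnitVectors R n)

variable {R n}

/-- The unit vector `(v, w)`, where `w` is a section of `v`. -/
def UnitVectors.mk (v w : Fin n → R) (h : v ⬝ᵥ w = 1) : UnitVectors R n := ⟨Sum.elim v w, h⟩

/-- The class of `(v, w)` modulo `SO_{2n}(R)` does not depend on the section `w` of `v`: the
alternating matrix `A = d w₁ᵗ - w₁ dᵗ`, where `d = w₂ - w₁`, satisfies `A v = d`. -/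
theorem orbit_section (v w₁ w₂ : Fin n → R) (h₁ : v ⬝ᵥ w₁ = 1) (h₂ : v ⬝ᵥ w₂ = 1) :
    (Quotient.mk'' (UnitVectors.mk v w₁ h₁) : UModSO R n) =
      Quotient.mk'' (UnitVectors.mk v w₂ h₂) := by
  set d := w₂ - w₁ with hd
  have hvd : v ⬝ᵥ d = 0 := by rw [hd, dotProduct_sub, h₁, h₂, sub_self]
  let A : Matrix (Fin n) (Fin n) R := vecMulVec d w₁ - vecMulVec w₁ d
  have hA : ∀ a : Fin n → R, A *ᵥ a = (w₁ ⬝ᵥ a) • d - (d ⬝ᵥ a) • w₁ := by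
    intro a
    simp [A, sub_mulVec, vecMulVec_mulVec]
  have hdet : (fromBlocks 1 0 A 1).det = 1 := by simp
  have hq : ∀ x, hypForm (fromBlocks 1 0 A 1 *ᵥ x) = hypForm x := by
    intro x
    obtain ⟨a, b, rfl⟩ : ∃ a b, x = Sum.elim a b :=
      ⟨x ∘ Sum.inl, x ∘ Sum.inr, (Sum.elim_comp_inl_inr x).symm⟩
    rw [fromBlocks_mulVec, Sum.elim_comp_inl, Sum.elim_comp_inr, hypForm_elim, hypForm_elim,
      hA, one_mulVec, zero_mulVec, add_zero, one_mulVec, dotProduct_add, dotProduct_sub,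
      dotProduct_smul, dotProduct_smul, dotProduct_comm a d, dotProduct_comm a w₁,
      smul_eq_mul, smul_eq_mul]
    ring
  refine Eq.symm (Quotient.sound' ⟨SO.mk _ hdet hq, Subtype.ext ?_⟩)
  change (fromBlocks 1 0 A 1 : Matrix (Fin n ⊕ Fin n) (Fin n ⊕ Fin n) R) *ᵥ Sum.elim v w₁ = Sum.elim v w₂
  rw [fromBlocks_mulVec, Sum.elim_comp_inl, Sum.elim_comp_inr, hA, dotProduct_comm w₁ v, h₁,
    dotProduct_comm d v, hvd, one_mulVec, zero_mulVec, add_zero, one_mulVec, one_smul, zero_smul,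
    sub_zero, hd, sub_add_cancel]

/-- The map `Um_n(R) → U_{2n-1}(R)/SO_{2n}(R)` that sends `v` to the class of `(v, w)`, where `w`
is any section of `v`. -/
noncomputable def toUModSO (v : Um R n) : UModSO R n :=
  Quotient.mk'' (UnitVectors.mk v.1 v.exists_section.choose v.exists_section.choose_spec)

theorem toUModSO_eq (v : Um R n) (w : Fin n → R) (h : v.1 ⬝ᵥ w = 1) :
    toUModSO v = Quotient.mk'' (UnitVectors.mk v.1 w h) :=
  orbit_section _ _ _ _ _

theorem toUModSO_smul (σ : SpecialLinearGroup (Fin n) R) (v : Um R n) :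
    toUModSO (σ • v) = toUModSO v := by
  obtain ⟨w, hw⟩ := v.exists_section
  have key : hypMatrix σ *ᵥ Sum.elim v.1 w = Sum.elim (σ • v).1
      (((σ⁻¹ : SpecialLinearGroup (Fin n) R) : Matrix (Fin n) (Fin n) R)ᵀ *ᵥ w) := by
    rw [hypMatrix, fromBlocks_mulVec, Sum.elim_comp_inl, Sum.elim_comp_inr, zero_mulVec,
      zero_mulVec, add_zero, zero_add]
    rfl
  have h' := hypForm_hypMatrix σ (Sum.elim v.1 w)
  rw [key, hypForm_elim, hypForm_elim, hw] at h'
  rw [toUModSO_eq v w hw, toUModSO_eq (σ • v) _ h']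
  exact Quotient.sound' ⟨hyp σ, Subtype.ext key⟩

/-- The comparison map `Um_n(R)/SL_n(R) → U_{2n-1}(R)/SO_{2n}(R)`. -/
noncomputable def comparisonMap : UmModSL R n → UModSO R n :=
  Quotient.lift toUModSO (by
    rintro _ v ⟨σ, rfl⟩
    exact toUModSO_smul σ v)

theorem comparisonMap_mk (v : Um R n) (w : Fin n → R) (h : v.1 ⬝ᵥ w = 1) :
    comparisonMap (Quotient.mk'' v) = Quotient.mk'' (UnitVectors.mk v.1 w h) :=
  toUModSO_eq v w h

/-- The unit vector `u_n = (e_n, e_n)` with `e_n = (1, 0, …, 0)`. -/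
def baseVector (hn : 0 < n) : UnitVectors R n :=
  UnitVectors.mk (Pi.single ⟨0, hn⟩ 1) (Pi.single ⟨0, hn⟩ 1) (by simp)

end UnitVec

namespace UnitVec

open Matrix

section

variable {R : Type*} [CommRing R] {n : ℕ}

/-! Everything rests on one equivalence, `mem_range_hyp_mul_EO_mul_stabilizer_iff`: the factorizable
`g` are those that keep the first component of `x` in its `SL_n(R)`-orbit. In one direction, `H(σ)`
acts on first components as `σ`, and `EO` preserves their orbits (`exists_fst_smul_of_mem_EO`). In
the other, `EO` is transitive on unit vectors with a fixed first component
(`exists_mem_EO_smul_eq_of_fst_eq`), so `g` can be corrected to fix `x`. The comparison map sends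
the class of `x.fst` to that of `x`. Hence it is surjective, and it is injective exactly when every
`g` has this property at every `x`. If `SO` is transitive, the property at a single `x` already
forces one `SL_n(R)`-orbit. -/

theorem elemMatrix_mulVec (i j : Fin n ⊕ Fin n) (z : R) (x : Fin n ⊕ Fin n → R) :
    elemMatrix i j z *ᵥ x =
      x + Pi.single i (z * x j) + Pi.single j.swap (-(z * x i.swap)) := by
  rw [elemMatrix, sub_mulVec, add_mulVec, one_mulVec, sub_eq_add_neg, Pi.single_neg]
  simp only [single_mulVec]
  rfl

theorem UnitVectors.fst_dotProduct_snd (x : UnitVectors R n) :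
    (x.1 ∘ Sum.inl) ⬝ᵥ (x.1 ∘ Sum.inr) = 1 := x.2

/-- The first component of a unit vector, which is unimodular. -/
def UnitVectors.fst (x : UnitVectors R n) : Um R n :=
  ⟨x.1 ∘ Sum.inl, (span_range_eq_top_iff _).2 ⟨_, x.fst_dotProduct_snd⟩⟩

theorem UnitVectors.mk_fst (x : UnitVectors R n) :
    UnitVectors.mk x.fst.1 (x.1 ∘ Sum.inr) x.fst_dotProduct_snd = x :=
  Subtype.ext (Sum.elim_comp_inl_inr x.1)

theorem comparisonMap_fst (x : UnitVectors R n) :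
    comparisonMap (Quotient.mk'' x.fst) = Quotient.mk'' x := by
  rw [comparisonMap_mk x.fst _ x.fst_dotProduct_snd, x.mk_fst]

theorem comparisonMap_surjective : Function.Surjective (comparisonMap (R := R) (n := n)) := by
  intro q
  induction q using Quotient.inductionOn' with
  | h x => exact ⟨_, comparisonMap_fst x⟩

theorem fst_hyp_smul (σ : SpecialLinearGroup (Fin n) R) (x : UnitVectors R n) :
    (hyp σ • x).fst = σ • x.fst := by
  refine Subtype.ext ?_
  change (hypMatrix σ *ᵥ x.1) ∘ Sum.inl = (σ : Matrix (Fin n) (Fin n) R) *ᵥ (x.1 ∘ Sum.inl)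
  rw [hypMatrix, fromBlocks_mulVec]
  simp

/-- If `d` is orthogonal to a section `w` of `v`, then `1 + d wᵗ` has determinant `1` and moves `v`
to `v + d`. -/
theorem exists_smul_eq_add (v v' : Um R n) (w d : Fin n → R) (hvw : v.1 ⬝ᵥ w = 1)
    (hd : w ⬝ᵥ d = 0) (hv' : v'.1 = v.1 + d) :
    ∃ σ : SpecialLinearGroup (Fin n) R, v' = σ • v := by
  refine ⟨⟨1 + vecMulVec d w, ?_⟩, Subtype.ext ?_⟩
  · rw [vecMulVec_eq Unit, det_one_add_replicateCol_mul_replicateRow, hd, add_zero]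
  · change v'.1 = (1 + vecMulVec d w) *ᵥ v.1
    rw [add_mulVec, one_mulVec, vecMulVec_mulVec, dotProduct_comm, hvw, hv']
    simp

/-- Generators in the diagonal blocks act on first components by a transvection, those in the lower
left block trivially. Those in the upper right block mix in the second component, so `σ` has to
depend on `x`. -/
theorem exists_fst_elem_smul {i j : Fin n ⊕ Fin n} (hij : i ≠ j) (z : R)
    (x : UnitVectors R n) :
    ∃ σ : SpecialLinearGroup (Fin n) R, (elem hij z • x).fst = σ • x.fst := by
  have key : (elem hij z • x).fst.1 =
      (x.1 + Pi.single i (z * x.1 j) + Pi.single j.swap (-(z * x.1 i.swap))) ∘ Sum.inl :=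
    congrArg (· ∘ Sum.inl) (elemMatrix_mulVec i j z x.1)
  rcases i with i | i <;> rcases j with j | j
  · have hne : i ≠ j := fun h => hij (congrArg _ h)
    refine ⟨⟨transvection i j z, det_transvection_of_ne _ _ hne z⟩, Subtype.ext ?_⟩
    rw [key]
    change _ = transvection i j z *ᵥ (x.1 ∘ Sum.inl)
    rw [transvection, add_mulVec, one_mulVec, single_mulVec]
    ext k
    simp [Pi.single_apply, Function.update_apply]
  -- With `b` the second component, the displacement `z (b_j e_i - b_i e_j)` is orthogonal to `b`.
  · refine exists_smul_eq_add _ _ (x.1 ∘ Sum.inr)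
      (Pi.single i (z * x.1 (Sum.inr j)) - Pi.single j (z * x.1 (Sum.inr i)))
      x.fst_dotProduct_snd ?_ ?_
    · simp only [dotProduct_sub, dotProduct_single, Function.comp_apply]
      ring
    · rw [key]
      ext k
      simp [Pi.single_apply, UnitVectors.fst]
      split_ifs <;> ring
  · refine ⟨1, Subtype.ext ?_⟩
    rw [key, one_smul]
    ext k
    simp [UnitVectors.fst]
  · have hne : j ≠ i := fun h => hij (congrArg _ h.symm)
    refine ⟨⟨transvection j i (-z), det_transvection_of_ne _ _ hne _⟩, Subtype.ext ?_⟩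
    rw [key]
    change _ = transvection j i (-z) *ᵥ (x.1 ∘ Sum.inl)
    rw [transvection, add_mulVec, one_mulVec, single_mulVec]
    ext k
    simp [Pi.single_apply, Function.update_apply]

/-- `EO_{2n}(R)` preserves the `SL_n(R)`-orbit of the first component of a unit vector. -/
theorem exists_fst_smul_of_mem_EO {g : SO R n} (hg : g ∈ EO R n) (x : UnitVectors R n) :
    ∃ σ : SpecialLinearGroup (Fin n) R, (g • x).fst = σ • x.fst := by
  -- Since `σ` depends on the vector, products and inverses need the hypothesis at translates of
  -- `x`.
  induction hg using Subgroup.closure_induction generalizing x with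
  | mem g hg =>
    obtain ⟨i, j, hij, z, -, rfl⟩ := hg
    exact exists_fst_elem_smul hij z x
  | one => exact ⟨1, by rw [one_smul, one_smul]⟩
  | mul g h _ _ ihg ihh =>
    obtain ⟨τ, hτ⟩ := ihh x
    obtain ⟨σ, hσ⟩ := ihg (h • x)
    exact ⟨σ * τ, by rw [mul_smul, hσ, hτ, mul_smul]⟩
  | inv g _ ih =>
    obtain ⟨σ, hσ⟩ := ih (g⁻¹ • x)
    exact ⟨σ⁻¹, by rw [eq_inv_smul_iff, ← hσ, smul_inv_smul]⟩

/-- Writing the alternating block as `B - Bᵀ` allows induction over arbitrary `B`: sums become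
products, diagonal matrix units contribute nothing, and off-diagonal ones give generators. -/
theorem exists_mem_EO_toMatrix_eq (B : Matrix (Fin n) (Fin n) R) :
    ∃ g ∈ EO R n, SO.toMatrix g = fromBlocks 1 0 (B - Bᵀ) 1 := by
  induction B using Matrix.induction_on' with
  | h_zero => exact ⟨1, one_mem _, by simp [SO.toMatrix_one]⟩
  | h_add A B hA hB =>
    obtain ⟨g, hg, hgA⟩ := hA
    obtain ⟨h, hh, hhB⟩ := hB
    refine ⟨g * h, mul_mem hg hh, ?_⟩
    rw [SO.toMatrix_mul, hgA, hhB, fromBlocks_multiply, transpose_add]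
    simp only [mul_one, one_mul, mul_zero, zero_mul, add_zero, zero_add]
    congr 1
    abel
  | h_std_basis i j z =>
    rcases eq_or_ne i j with rfl | hij
    · exact ⟨1, one_mem _, by simp [SO.toMatrix_one]⟩
    · refine ⟨elem (i := Sum.inr i) (j := Sum.inl j) Sum.inr_ne_inl z,
        Subgroup.subset_closure ⟨_, _, Sum.inr_ne_inl, z, by simpa using hij, rfl⟩, ?_⟩
      change elemMatrix _ _ _ = _
      ext (k | k) (l | l) <;> simp [elemMatrix, single_apply, one_apply]

/-- `EO_{2n}(R)` acts transitively on the sections of a unimodular vector. -/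
theorem exists_mem_EO_smul_eq_of_fst_eq (x y : UnitVectors R n) (h : x.fst = y.fst) :
    ∃ g ∈ EO R n, g • x = y := by
  obtain ⟨a, w, hx, rfl⟩ : ∃ a w h, UnitVectors.mk a w h = x := ⟨_, _, _, x.mk_fst⟩
  obtain ⟨a', w', hy, rfl⟩ : ∃ a w h, UnitVectors.mk a w h = y := ⟨_, _, _, y.mk_fst⟩
  obtain rfl : a = a' := congrArg Subtype.val h
  -- As `w` and `w'` both pair to `1` with `a`, this `B` satisfies `(B - Bᵀ) a = w' - w`.
  obtain ⟨g, hg, hgB⟩ := exists_mem_EO_toMatrix_eq (vecMulVec (w' - w) w)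
  refine ⟨g, hg, Subtype.ext ?_⟩
  change SO.toMatrix g *ᵥ Sum.elim a w = Sum.elim a w'
  rw [hgB, fromBlocks_mulVec, Sum.elim_comp_inl, Sum.elim_comp_inr, transpose_vecMulVec,
    sub_mulVec, vecMulVec_mulVec, vecMulVec_mulVec, sub_dotProduct, dotProduct_comm w a,
    dotProduct_comm w' a, hx, hy]
  simp

/-- The first components of `x` and `g x` lie in the same `SL_n(R)`-orbit if and only if
`g ∈ H(SL_n(R)) EO_{2n}(R) St(x)`. -/
theorem mem_range_hyp_mul_EO_mul_stabilizer_iff (g : SO R n) (x : UnitVectors R n) :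
    g ∈ ((hyp (R := R) (n := n)).range : Set (SO R n)) * (EO R n : Set (SO R n)) *
        (MulAction.stabilizer (SO R n) x : Set (SO R n)) ↔
      ∃ σ : SpecialLinearGroup (Fin n) R, (g • x).fst = σ • x.fst := by
  constructor
  · rintro ⟨_, ⟨_, ⟨σ, rfl⟩, ε, hε, rfl⟩, s, hs, rfl⟩
    obtain ⟨τ, hτ⟩ := exists_fst_smul_of_mem_EO hε x
    refine ⟨σ * τ, ?_⟩
    simp only [mul_smul]
    rw [show s • x = x from hs, fst_hyp_smul, hτ]
  · rintro ⟨σ, hσ⟩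
    -- Undoing `σ` restores the first component of `x`, so some `ε` carries `x` to `H(σ)⁻¹ g x`;
    -- then `(H(σ) ε)⁻¹ g` fixes `x`.
    obtain ⟨ε, hε, hεx⟩ := exists_mem_EO_smul_eq_of_fst_eq x ((hyp σ)⁻¹ • g • x) (by
      rw [← map_inv, fst_hyp_smul, hσ, inv_smul_smul])
    refine Set.mem_mul.2 ⟨hyp σ * ε, Set.mul_mem_mul ⟨σ, rfl⟩ hε, (hyp σ * ε)⁻¹ * g, ?_,
      mul_inv_cancel_left _ _⟩
    change ((hyp σ * ε)⁻¹ * g) • x = x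
    rw [mul_smul, inv_smul_eq_iff, mul_smul, hεx, smul_inv_smul]

theorem univ_eq_range_hyp_mul_EO_mul_stabilizer_iff (x : UnitVectors R n) :
    (Set.univ : Set (SO R n)) = ((hyp (R := R) (n := n)).range : Set (SO R n)) *
        (EO R n : Set (SO R n)) * (MulAction.stabilizer (SO R n) x : Set (SO R n)) ↔
      ∀ g : SO R n, ∃ σ : SpecialLinearGroup (Fin n) R, (g • x).fst = σ • x.fst := by
  rw [eq_comm, Set.eq_univ_iff_forall]
  exact forall_congr' fun g => mem_range_hyp_mul_EO_mul_stabilizer_iff g x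

theorem comparisonMap_injective_iff :
    Function.Injective (comparisonMap (R := R) (n := n)) ↔
      ∀ (x : UnitVectors R n) (g : SO R n),
        ∃ σ : SpecialLinearGroup (Fin n) R, (g • x).fst = σ • x.fst := by
  constructor
  · intro hinj x g
    have h : (Quotient.mk'' (g • x).fst : UmModSL R n) = Quotient.mk'' x.fst := hinj (by
      rw [comparisonMap_fst, comparisonMap_fst]
      exact Quotient.sound' ⟨g, rfl⟩)
    obtain ⟨σ, hσ⟩ := Quotient.exact' h
    exact ⟨σ, hσ.symm⟩
  · intro H p q hpq
    induction p using Quotient.inductionOn' with | h v => ?_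
    induction q using Quotient.inductionOn' with | h v' => ?_
    obtain ⟨w, hw⟩ := v.exists_section
    obtain ⟨w', hw'⟩ := v'.exists_section
    rw [comparisonMap_mk v w hw, comparisonMap_mk v' w' hw'] at hpq
    obtain ⟨g, hg⟩ := Quotient.exact' hpq
    obtain ⟨σ, hσ⟩ := H (UnitVectors.mk v'.1 w' hw') g
    refine Quotient.sound' ⟨σ, hσ.symm.trans ?_⟩
    exact congrArg UnitVectors.fst hg

/-- If `SO_{2n}(R)` acts transitively and preserves the `SL_n(R)`-orbit of the first component of
`x`, then every unimodular vector lies in that orbit. -/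
theorem subsingleton_UmModSL [Subsingleton (UModSO R n)] (x : UnitVectors R n)
    (h : ∀ g : SO R n, ∃ σ : SpecialLinearGroup (Fin n) R, (g • x).fst = σ • x.fst) :
    Subsingleton (UmModSL R n) := by
  refine subsingleton_of_forall_eq (Quotient.mk'' x.fst) fun q => ?_
  induction q using Quotient.inductionOn' with | h v => ?_
  obtain ⟨w, hw⟩ := v.exists_section
  obtain ⟨g, hg⟩ := Quotient.exact' (Subsingleton.elim
    (Quotient.mk'' (UnitVectors.mk v.1 w hw) : UModSO R n) (Quotient.mk'' x))
  obtain ⟨σ, hσ⟩ := h g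
  exact Quotient.sound' ⟨σ, hσ.symm.trans (congrArg UnitVectors.fst hg)⟩

end

end UnitVec

theorem mainTheorem7 {R : Type*} [CommRing R] (h2 : IsUnit (2 : R)) (n : ℕ) (hn : 3 ≤ n) :
    Function.Surjective (UnitVec.comparisonMap (R := R) (n := n)) ∧
    (Function.Injective (UnitVec.comparisonMap (R := R) (n := n)) ↔
      ∀ x : UnitVec.UnitVectors R n,
        (Set.univ : Set (UnitVec.SO R n)) =
          ((UnitVec.hyp (R := R) (n := n)).range : Set (UnitVec.SO R n)) *
            (UnitVec.EO R n : Set (UnitVec.SO R n)) *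
            (MulAction.stabilizer (UnitVec.SO R n) x : Set (UnitVec.SO R n))) ∧
    (Nat.card (UnitVec.UmModSL R n) = 1 ↔
      Nat.card (UnitVec.UModSO R n) = 1 ∧
        (Set.univ : Set (UnitVec.SO R n)) =
          ((UnitVec.hyp (R := R) (n := n)).range : Set (UnitVec.SO R n)) *
            (UnitVec.EO R n : Set (UnitVec.SO R n)) *
            (MulAction.stabilizer (UnitVec.SO R n)
              (UnitVec.baseVector (R := R) (n := n) (Nat.zero_lt_of_lt hn)) :
                Set (UnitVec.SO R n))) := by
  simp only [UnitVec.univ_eq_range_hyp_mul_EO_mul_stabilizer_iff]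
  refine ⟨UnitVec.comparisonMap_surjective, UnitVec.comparisonMap_injective_iff, ?_⟩
  simp only [Nat.card_eq_one_iff_unique]
  constructor
  · rintro ⟨_, _⟩
    exact ⟨⟨UnitVec.comparisonMap_surjective.subsingleton,
      Nonempty.map UnitVec.comparisonMap inferInstance⟩,
      -- A map out of a one-point space is injective, so the condition holds at every unit vector,
      -- in particular at `u_n`.
      UnitVec.comparisonMap_injective_iff.1 (Function.injective_of_subsingleton _) _⟩
  · rintro ⟨⟨_, _⟩, h⟩
    exact ⟨UnitVec.subsingleton_UmModSL _ h,
      ⟨Quotient.mk'' (UnitVec.baseVector (Nat.zero_lt_of_lt hn)).fst⟩⟩
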